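/- Let $\mathbb{D}=\{z\in\mathbb{C}:|z|<1\}$. For $\mu,\nu>0$ and $a,b\in\mathbb{C}$ the four-parameter Wright function is $$\mathcal{W}_{(\mu,a),(\nu,b)}(z)=\sum_{k=0}^{\infty}\frac{z^k}{\Gamma(a+k\mu)\,\Gamma(b+k\nu)},$$ where $1/\Gamma$ is taken to be $0$ at the poles of $\Gamma$. Let $\mathcal{K}$ be the class of functions $f$ that are analytic and injective on $\mathbb{D}$, satisfy $f(0)=0$ and $f'(0)=1$, and have convex image $f(\mathbb{D})$. A function $g$ on $\mathbb{D}$ is subordinate to $f$, written $g\prec f$, if there is an analytic $w:\mathbb{D}\to\mathbb{D}$ with $w(0)=0$ and $g=f\circ w$ on $\mathbb{D}$. A sequence $\{\beta_n\}_{n\ge1}$ of complex numbers is called a subordinating factor sequence if for every $f(z)=\sum_{n\ge1}\alpha_nz^n$ in $\mathcal{K}$ the series $\sum_{n\ge1}\alpha_n\beta_nz^n$ converges on $\mathbb{D}$ and its sum is subordinate to $f$. **Theorem.** Let $\mu,\nu\ge2$ be real numbers. Then: (i) for every $z\in\mathbb{D}$ the series defining $\mathcal{W}_{(\mu,1),(\nu,1)}(z)$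 converges absolutely and $\operatorname{Re}\,\mathcal{W}_{(\mu,1),(\nu,1)}(z)>\tfrac12$; (ii) the sequence $\left\{\dfrac{1}{\Gamma(1+k\mu)\,\Gamma(1+k\nu)}\right\}_{k\ge1}$ is a subordinating factor sequence. -/

import Mathlib

noncomputable section

/-- The open unit disk in the complex plane. -/
def unitDisk : Set ℂ := Metric.ball 0 1

/-- The `k`-th term of the four-parameter Wright series. Since `Complex.Gamma` takes the value `0`
at its poles and `x / 0 = 0`, the reciprocal Gamma factors have their usual value `0` there. -/
def wrightTerm (μ : ℝ) (a : ℂ) (ν : ℝ) (b : ℂ) (z : ℂ) (k : ℕ) : ℂ :=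
  z ^ k / (Complex.Gamma (a + k * μ) * Complex.Gamma (b + k * ν))

/-- The four-parameter Wright function with parameters `(μ, a), (ν, b)`. -/
def wright (μ : ℝ) (a : ℂ) (ν : ℝ) (b : ℂ) (z : ℂ) : ℂ :=
  ∑' k : ℕ, wrightTerm μ a ν b z k

/-- The class of normalized convex univalent functions on the open unit disk. -/
structure IsConvexUnivalent (f : ℂ → ℂ) : Prop where
  holomorphic : DifferentiableOn ℂ f unitDisk
  map_zero : f 0 = 0
  deriv_zero : deriv f 0 = 1
  univalent : Set.InjOn f unitDisk
  convex_image : Convex ℝ (f '' unitDisk)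

/-- `g` is subordinate to `f` on the unit disk: `g = f ∘ w` there for some Schwarz function `w`. -/
def IsSubordinate (g f : ℂ → ℂ) : Prop :=
  ∃ w : ℂ → ℂ, DifferentiableOn ℂ w unitDisk ∧ w 0 = 0 ∧ Set.MapsTo w unitDisk unitDisk ∧
    ∀ z ∈ unitDisk, g z = f (w z)

/-- A sequence `β 1, β 2, …` (the value `β 0` plays no role) is a subordinating factor sequence if,
for every normalized convex univalent `f z = ∑_{n ≥ 1} α n * z ^ n`, the series
`∑_{n ≥ 1} α n * β n * z ^ n` converges on the unit disk to a function subordinate to `f`. -/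
def IsSubordinatingFactorSeq (β : ℕ → ℂ) : Prop :=
  ∀ (f : ℂ → ℂ) (α : ℕ → ℂ), IsConvexUnivalent f →
    (∀ z ∈ unitDisk, HasSum (fun n : ℕ => α (n + 1) * z ^ (n + 1)) (f z)) →
    ∃ g : ℂ → ℂ,
      (∀ z ∈ unitDisk, HasSum (fun n : ℕ => α (n + 1) * β (n + 1) * z ^ (n + 1)) (g z)) ∧
      IsSubordinate g f

end

open MeasureTheory Filter Topology Set AddCircle

/-! For `μ ≥ 2` one has `Γ(1 + kμ) ≥ (2k)! ≥ 2 ^ k`, so the `k`-th coefficient has modulus at most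
`4 ^ (-k)` and those with `k ≥ 1` sum to at most `1/3`. Hence the real part in (i) is at least
`2/3`.

Part (ii) uses only that `∑ |β n| ≤ 1/2`. Then `p(t) = 1 + 2 Re ∑ β n e^{-int}` is a nonnegative
density of total mass one, and by orthogonality `∑ α n β n z^n` is the `p`-average of `f (z
e^{it})`. Since `f(𝔻)` is convex and open, the average stays in it
(`Convex.integral_smul_mem_of_isOpen`). Composing with the holomorphic inverse of `f` gives the
Schwarz function. -/

/-! ### Inverses of injective holomorphic functions -/

/-- An injective holomorphic function on a preconnected open set is open there. -/
theorem Set.InjOn.isOpen_image_of_differentiableOn {f : ℂ → ℂ} {U : Set ℂ} (hU : IsOpen U)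
    (hUc : IsPreconnected U) (hf : DifferentiableOn ℂ f U) (hinj : InjOn f U) {V : Set ℂ}
    (hVU : V ⊆ U) (hV : IsOpen V) : IsOpen (f '' V) := by
  rcases (hf.analyticOnNhd hU).is_constant_or_isOpen hUc with ⟨w, hw⟩ | h
  · rcases V.eq_empty_or_nonempty with rfl | ⟨z, hz⟩
    · simp
    obtain ⟨y, hyz, hyV⟩ := (dense_compl_singleton z).inter_nhds_nonempty (hV.mem_nhds hz)
    exact absurd (hinj (hVU hyV) (hVU hz) ((hw y (hVU hyV)).trans (hw z (hVU hz)).symm)) hyz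
  · exact h V hVU hV

/-- The inverse of an injective holomorphic function on a preconnected open set is continuous. -/
theorem Set.InjOn.continuousAt_invFunOn_of_differentiableOn {f : ℂ → ℂ} {U : Set ℂ}
    (hU : IsOpen U) (hUc : IsPreconnected U) (hf : DifferentiableOn ℂ f U) (hinj : InjOn f U)
    {z : ℂ} (hz : z ∈ U) : ContinuousAt (Function.invFunOn f U) (f z) := by
  rw [ContinuousAt, hinj.leftInvOn_invFunOn hz]
  intro V hV
  obtain ⟨W, hWV, hW, hzW⟩ := mem_nhds_iff.1 (inter_mem hV (hU.mem_nhds hz))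
  have hWU : W ⊆ U := hWV.trans inter_subset_right
  refine mem_map.2 (mem_of_superset ((hinj.isOpen_image_of_differentiableOn hU hUc hf hWU hW).mem_nhds
    (mem_image_of_mem f hzW)) ?_)
  rintro _ ⟨y, hy, rfl⟩
  rw [mem_preimage, hinj.leftInvOn_invFunOn (hWU hy)]
  exact (hWV hy).1

/-- The inverse of an injective holomorphic function on a preconnected open set is holomorphic. -/
theorem Set.InjOn.differentiableOn_invFunOn {f : ℂ → ℂ} {U : Set ℂ} (hU : IsOpen U)
    (hUc : IsPreconnected U) (hf : DifferentiableOn ℂ f U) (hinj : InjOn f U) :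
    DifferentiableOn ℂ (Function.invFunOn f U) (f '' U) := by
  have hinv : ∀ y ∈ U, deriv f y ≠ 0 →
      DifferentiableAt ℂ (Function.invFunOn f U) (f y) := by
    intro y hy hne
    refine (HasDerivAt.of_local_left_inverse (f := f) (f' := deriv f y)
      (hinj.continuousAt_invFunOn_of_differentiableOn hU hUc hf hy) ?_ hne ?_).differentiableAt
    · rw [hinj.leftInvOn_invFunOn hy]
      exact (hf.differentiableAt (hU.mem_nhds hy)).hasDerivAt
    · filter_upwards [(hinj.isOpen_image_of_differentiableOn hU hUc hf Subset.rfl hU).mem_nhds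
        (mem_image_of_mem f hy)] with w hw
      exact Function.invFunOn_eq hw
  rintro _ ⟨z, hz, rfl⟩
  refine DifferentiableAt.differentiableWithinAt ?_
  have han : AnalyticAt ℂ (deriv f) z := (hf.analyticOnNhd hU z hz).deriv
  -- If `f'` vanished near `z`, `f` would be constant on a ball, against injectivity. Otherwise the
  -- inverse is differentiable on a punctured neighbourhood of `f z` and continuous at `f z`, so the
  -- singularity is removable.
  rcases han.eventually_eq_zero_or_eventually_ne_zero with h | h
  · exfalso
    obtain ⟨r, hr, hball⟩ := Metric.mem_nhds_iff.1 (inter_mem h (hU.mem_nhds hz))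
    obtain ⟨y, hyz, hy⟩ :=
      (dense_compl_singleton z).inter_nhds_nonempty (Metric.ball_mem_nhds z hr)
    refine hyz (hinj (hball hy).2 hz ?_)
    refine Metric.isOpen_ball.is_const_of_deriv_eq_zero
      (convex_ball z r).isPreconnected
      (hf.mono fun x hx => (hball hx).2) (fun x hx => (hball hx).1) hy (Metric.mem_ball_self hr)
  · obtain ⟨V, hVs, hV, hzV⟩ :=
      mem_nhds_iff.1 (inter_mem (eventually_nhdsWithin_iff.1 h) (hU.mem_nhds hz))
    have hVU : V ⊆ U := hVs.trans inter_subset_right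
    have hnhds : f '' V ∈ 𝓝 (f z) :=
      (hinj.isOpen_image_of_differentiableOn hU hUc hf hVU hV).mem_nhds (mem_image_of_mem f hzV)
    refine ((Complex.differentiableOn_compl_singleton_and_continuousAt_iff hnhds).1
      ⟨?_, hinj.continuousAt_invFunOn_of_differentiableOn hU hUc hf hz⟩).differentiableAt hnhds
    rintro _ ⟨⟨y, hy, rfl⟩, hyz⟩
    have hne : y ≠ z := fun h => hyz (by simp [h])
    exact (hinv y (hVU hy) ((hVs hy).1 hne)).differentiableWithinAt

/-! ### Weighted averages in convex sets -/

/-- A weighted average of a continuous function on a compact space with values in an open convex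
set lies in that set. -/
theorem Convex.integral_smul_mem_of_isOpen {X E : Type*} [TopologicalSpace X] [CompactSpace X]
    [MeasurableSpace X] [BorelSpace X] [NormedAddCommGroup E] [NormedSpace ℝ E] [CompleteSpace E]
    [SecondCountableTopologyEither X E] {m : Measure X} [IsFiniteMeasure m] {s : Set E}
    (hs : Convex ℝ s) (hso : IsOpen s) {p : X → ℝ} (hp : Continuous p) (hp0 : ∀ x, 0 ≤ p x)
    (hp1 : ∫ x, p x ∂m = 1) {F : X → E} (hFc : Continuous F) (hF : ∀ x, F x ∈ s) :
    ∫ x, p x • F x ∂m ∈ s := by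
  by_contra hmem
  -- `l` is strictly smaller on `s` than at the average; by compactness `l ∘ F` attains its maximum,
  -- which bounds `l` of the average and lies in `l '' s`.
  obtain ⟨l, hl⟩ := geometric_hahn_banach_open_point hs hso hmem
  have : Nonempty X := by
    by_contra hX
    rw [not_nonempty_iff] at hX
    simp [integral_of_isEmpty] at hp1
  obtain ⟨x₀, -, hx₀⟩ := isCompact_univ.exists_isMaxOn univ_nonempty
    (l.continuous.comp hFc).continuousOn
  have hpF : Continuous fun x => p x * l (F x) := hp.mul (l.continuous.comp hFc)
  have hle : ∫ x, p x * l (F x) ∂m ≤ ∫ x, p x * l (F x₀) ∂m :=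
    integral_mono (hpF.integrable_of_hasCompactSupport (HasCompactSupport.of_compactSpace _))
      ((hp.mul continuous_const).integrable_of_hasCompactSupport
        (HasCompactSupport.of_compactSpace _))
      fun x => mul_le_mul_of_nonneg_left (hx₀ (mem_univ x)) (hp0 x)
  have heq : l (∫ x, p x • F x ∂m) = ∫ x, p x * l (F x) ∂m := by
    have hint : Integrable (fun x => p x • F x) m :=
      (hp.smul hFc).integrable_of_hasCompactSupport (HasCompactSupport.of_compactSpace _)
    rw [← l.integral_comp_comm hint]
    simp
  rw [integral_mul_const, hp1, one_mul, ← heq] at hle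
  exact (hl _ (hF x₀)).not_ge hle

/-! ### Absolutely convergent trigonometric series -/

section Fourier

variable {T : ℝ}

theorem norm_fourier_apply (n : ℤ) (t : AddCircle T) : ‖fourier n t‖ = 1 := by
  rw [fourier_apply]; exact Circle.norm_coe _

theorem continuous_tsum_mul_fourier {c : ℕ → ℂ} (hc : Summable fun n => ‖c n‖) (e : ℕ → ℤ) :
    Continuous fun t : AddCircle T => ∑' n, c n * fourier (e n) t :=
  continuous_tsum (fun n => continuous_const.mul (fourier (e n)).continuous) hc
    (fun n t => by rw [norm_mul, norm_fourier_apply, mul_one])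

/-- The function `1 + 2 Re ∑ b n e^{-i (n + 1) t}`. -/
noncomputable def trigDensity (b : ℕ → ℂ) (t : AddCircle T) : ℝ :=
  1 + 2 * (∑' n, b n * fourier (-((n : ℤ) + 1)) t).re

theorem continuous_trigDensity {b : ℕ → ℂ} (hb : Summable fun n => ‖b n‖) :
    Continuous (trigDensity (T := T) b) :=
  continuous_const.add (continuous_const.mul
    (Complex.continuous_re.comp (continuous_tsum_mul_fourier hb _)))

theorem trigDensity_nonneg {b : ℕ → ℂ} (hb : Summable fun n => ‖b n‖)
    (hb' : ∑' n, ‖b n‖ ≤ 1 / 2) (t : AddCircle T) : 0 ≤ trigDensity b t := by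
  have h1 : ‖∑' n, b n * fourier (-((n : ℤ) + 1)) t‖ ≤ ∑' n, ‖b n‖ :=
    tsum_of_norm_bounded hb.hasSum (fun n => by rw [norm_mul, norm_fourier_apply, mul_one])
  have h2 := (abs_le.1 (Complex.abs_re_le_norm (∑' n, b n * fourier (-((n : ℤ) + 1)) t))).1
  rw [trigDensity]
  linarith

theorem trigDensity_eq {b : ℕ → ℂ} (t : AddCircle T) :
    (trigDensity b t : ℂ) = 1 + ((∑' n, b n * fourier (-((n : ℤ) + 1)) t) +
      ∑' n, (starRingEnd ℂ) (b n) * fourier ((n : ℤ) + 1) t) := by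
  have h : ∑' n, (starRingEnd ℂ) (b n) * fourier ((n : ℤ) + 1) t =
      (starRingEnd ℂ) (∑' n, b n * fourier (-((n : ℤ) + 1)) t) := by
    rw [Complex.conj_tsum]
    refine tsum_congr fun n => ?_
    rw [map_mul, fourier_neg, Complex.conj_conj]
  rw [h, Complex.add_conj, trigDensity]
  push_cast
  ring

variable [hT : Fact (0 < T)]

theorem integral_fourier_haarAddCircle (n : ℤ) :
    ∫ t, fourier n t ∂(haarAddCircle (T := T)) = if n = 0 then 1 else 0 := by
  have h := congrFun (fourierCoeff_fourier (T := T) n) 0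
  simp only [fourierCoeff, neg_zero, fourier_zero, one_smul] at h
  rw [h, Pi.single_apply]
  simp [eq_comm]

/-- The factor `φ` is general because it serves both as a character and as the density itself. -/
theorem hasSum_integral_tsum_mul_fourier {c : ℕ → ℂ} (hc : Summable fun n => ‖c n‖) (e : ℕ → ℤ)
    {φ : AddCircle T → ℂ} (hφ : Continuous φ) :
    HasSum (fun n => c n * ∫ t, fourier (e n) t * φ t ∂haarAddCircle)
      (∫ t, (∑' n, c n * fourier (e n) t) * φ t ∂haarAddCircle) := by
  have hint : ∀ ψ : AddCircle T → ℂ, Continuous ψ → Integrable ψ haarAddCircle := fun ψ h =>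
    h.integrable_of_hasCompactSupport (HasCompactSupport.of_compactSpace _)
  have h := hasSum_integral_of_summable_integral_norm (μ := haarAddCircle (T := T))
    (F := fun n t => c n * (fourier (e n) t * φ t))
    (fun n => hint _ (by fun_prop)) (by
      simp only [norm_mul, norm_fourier_apply, one_mul, integral_const_mul]
      exact hc.mul_right _)
  simp only [integral_const_mul] at h
  simpa only [← mul_assoc, tsum_mul_right] using h

theorem integral_tsum_mul_fourier_mul_fourier {c : ℕ → ℂ} (hc : Summable fun n => ‖c n‖)
    (e : ℕ → ℤ) (m : ℤ) :
    ∫ t : AddCircle T, (∑' n, c n * fourier (e n) t) * fourier m t ∂haarAddCircle =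
      ∑' n, if e n + m = 0 then c n else 0 := by
  rw [← (hasSum_integral_tsum_mul_fourier hc e (fourier m).continuous).tsum_eq]
  refine tsum_congr fun n => ?_
  simp only [← fourier_add, integral_fourier_haarAddCircle]
  simp

/-- Only frequency `-m` survives integration. The conjugate half has positive frequencies, so it
drops out for `m ≥ 0`; `b n` sits at frequency `-(n + 1)`, whence the shift to `m - 1`. -/
theorem integral_trigDensity_mul_fourier {b : ℕ → ℂ} (hb : Summable fun n => ‖b n‖) (m : ℕ) :
    ∫ t : AddCircle T, (trigDensity b t : ℂ) * fourier (m : ℤ) t ∂haarAddCircle =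
      if m = 0 then 1 else b (m - 1) := by
  have hint : ∀ ψ : AddCircle T → ℂ, Continuous ψ → Integrable ψ haarAddCircle := fun ψ h =>
    h.integrable_of_hasCompactSupport (HasCompactSupport.of_compactSpace _)
  have hb' : Summable fun n => ‖(starRingEnd ℂ) (b n)‖ := by simpa using hb
  have hc1 := continuous_tsum_mul_fourier (T := T) hb fun n => -((n : ℤ) + 1)
  have hc2 := continuous_tsum_mul_fourier (T := T) hb' fun n => (n : ℤ) + 1
  simp only [trigDensity_eq, add_mul, one_mul]
  have hm := (fourier (T := T) m).continuous
  rw [integral_add (hint _ hm) (hint _ (by fun_prop)), integral_add (hint _ (by fun_prop))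
      (hint _ (by fun_prop)),
    integral_tsum_mul_fourier_mul_fourier hb, integral_tsum_mul_fourier_mul_fourier hb',
    integral_fourier_haarAddCircle]
  have h2 : ∀ n : ℕ, (n : ℤ) + 1 + m ≠ 0 := fun n => by omega
  simp only [h2, if_false, tsum_zero, add_zero]
  rcases m with _ | m
  · have h1 : ∀ n : ℕ, -((n : ℤ) + 1) + (0 : ℕ) ≠ 0 := fun n => by omega
    simp only [h1, if_false, tsum_zero]
    simp
  · rw [tsum_eq_single m (fun n hn => if_neg (by omega))]
    have : (m : ℤ) + 1 ≠ 0 := by omega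
    simp [this]

theorem integral_trigDensity {b : ℕ → ℂ} (hb : Summable fun n => ‖b n‖) :
    ∫ t : AddCircle T, trigDensity b t ∂haarAddCircle = 1 := by
  have h := integral_trigDensity_mul_fourier (T := T) hb 0
  simp only [Nat.cast_zero, fourier_zero, mul_one, if_true] at h
  rw [integral_complex_ofReal] at h
  exact_mod_cast h

/-- Weighting an absolutely convergent power series on a circle by `trigDensity b` multiplies its
coefficients by `b`. -/
theorem integral_trigDensity_mul_tsum {b c : ℕ → ℂ} (hb : Summable fun n => ‖b n‖)
    (hc : Summable fun n => ‖c n‖) :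
    ∫ t : AddCircle T, (trigDensity b t : ℂ) * ∑' n, c n * fourier ((n : ℤ) + 1) t ∂haarAddCircle =
      ∑' n, c n * b n := by
  have h := hasSum_integral_tsum_mul_fourier (T := T) hc (fun n => (n : ℤ) + 1)
    (φ := fun t => (trigDensity b t : ℂ)) (Complex.continuous_ofReal.comp (continuous_trigDensity hb))
  simp only [mul_comm _ (trigDensity b _ : ℂ)] at h
  rw [← h.tsum_eq]
  refine tsum_congr fun n => ?_
  have := integral_trigDensity_mul_fourier (T := T) hb (n + 1)
  push_cast at this
  rw [this]

end Fourier

/-! ### Subordinating factor sequences -/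

/-- The Hadamard product of a convex univalent function with a sequence of small `ℓ¹` norm takes
its values in the image of the function. -/
theorem IsConvexUnivalent.tsum_mul_mem_image {f : ℂ → ℂ} (hf : IsConvexUnivalent f) {α b : ℕ → ℂ}
    (hα : ∀ z ∈ unitDisk, HasSum (fun n : ℕ => α (n + 1) * z ^ (n + 1)) (f z))
    (hb : Summable fun n => ‖b n‖) (hb' : ∑' n, ‖b n‖ ≤ 1 / 2) {z : ℂ} (hz : z ∈ unitDisk) :
    ∑' n, α (n + 1) * z ^ (n + 1) * b n ∈ f '' unitDisk := by
  have hmem : ∀ t : UnitAddCircle, z * fourier 1 t ∈ unitDisk := fun t => by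
    simpa only [unitDisk, mem_ball_zero_iff, norm_mul, norm_fourier_apply, mul_one] using hz
  have hFt : ∀ t : UnitAddCircle, f (z * fourier 1 t) =
      ∑' n, (α (n + 1) * z ^ (n + 1)) * fourier ((n : ℤ) + 1) t := by
    intro t
    rw [← (hα _ (hmem t)).tsum_eq]
    refine tsum_congr fun n => ?_
    have : fourier ((n : ℤ) + 1) t = fourier 1 t ^ (n + 1) := by
      rw [fourier_one, fourier_apply, ← Circle.coe_pow, ← AddCircle.toCircle_nsmul]
      norm_cast
    rw [this, mul_pow, mul_assoc]
  have hopen : IsOpen (f '' unitDisk) := hf.univalent.isOpen_image_of_differentiableOn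
    Metric.isOpen_ball (convex_ball 0 1).isPreconnected hf.holomorphic Subset.rfl Metric.isOpen_ball
  have h := hf.convex_image.integral_smul_mem_of_isOpen hopen (m := haarAddCircle (T := 1))
    (continuous_trigDensity hb) (trigDensity_nonneg hb hb') (integral_trigDensity hb)
    (F := fun t : UnitAddCircle => f (z * fourier 1 t))
    (hf.holomorphic.continuousOn.comp_continuous
      (continuous_const.mul (fourier 1).continuous) hmem)
    (fun t => mem_image_of_mem f (hmem t))
  simp only [Complex.real_smul, hFt] at h
  rwa [integral_trigDensity_mul_tsum hb (hα z hz).summable.norm] at h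

/-- A function vanishing at the origin with values in the image of a univalent function is
subordinate to it. -/
theorem IsConvexUnivalent.isSubordinate {f g : ℂ → ℂ} (hf : IsConvexUnivalent f)
    (hg : DifferentiableOn ℂ g unitDisk) (hg0 : g 0 = 0)
    (hgf : MapsTo g unitDisk (f '' unitDisk)) : IsSubordinate g f := by
  have h0 : (0 : ℂ) ∈ unitDisk := Metric.mem_ball_self one_pos
  refine ⟨fun z => Function.invFunOn f unitDisk (g z),
    (hf.univalent.differentiableOn_invFunOn Metric.isOpen_ball (convex_ball 0 1).isPreconnected
      hf.holomorphic).comp hg hgf, ?_, fun z hz => Function.invFunOn_mem (hgf hz),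
    fun z hz => (Function.invFunOn_eq (hgf hz)).symm⟩
  have := hf.univalent.leftInvOn_invFunOn h0
  rw [hf.map_zero] at this
  simpa only [hg0] using this

/-- Summability in `ℂ` is absolute, so the series at a real radius `r` between `‖z‖` and `1` is a
Weierstrass majorant on the ball of radius `r`. -/
theorem differentiableOn_tsum_pow_unitDisk {a : ℕ → ℂ}
    (ha : ∀ z ∈ unitDisk, Summable fun n => a n * z ^ (n + 1)) :
    DifferentiableOn ℂ (fun z => ∑' n, a n * z ^ (n + 1)) unitDisk := by
  intro z hz
  have hz' : ‖z‖ < 1 := by simpa [unitDisk] using hz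
  obtain ⟨r, hzr, hr1⟩ := exists_between hz'
  have hr0 : 0 ≤ r := (norm_nonneg z).trans hzr.le
  have hs : Summable fun n => ‖a n * (r : ℂ) ^ (n + 1)‖ :=
    (ha r (by simpa [unitDisk, abs_of_nonneg hr0] using hr1)).norm
  have hd := Complex.differentiableOn_tsum_of_summable_norm hs
    (F := fun n w => a n * w ^ (n + 1)) (U := Metric.ball 0 r)
    (fun n => by fun_prop) Metric.isOpen_ball (fun n w hw => by
      have hw' : ‖w‖ ≤ r := by simpa using (Metric.mem_ball.1 hw).le
      rw [norm_mul, norm_mul, norm_pow, norm_pow, Complex.norm_of_nonneg hr0]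
      gcongr)
  exact (hd.differentiableAt (Metric.isOpen_ball.mem_nhds (by simpa using hzr))).differentiableWithinAt

/-- A sequence with `∑ ‖β n‖ ≤ 1 / 2` is a subordinating factor sequence. -/
theorem isSubordinatingFactorSeq_of_tsum_norm_le {β : ℕ → ℂ}
    (hβ : Summable fun n => ‖β (n + 1)‖) (hβ' : ∑' n, ‖β (n + 1)‖ ≤ 1 / 2) :
    IsSubordinatingFactorSeq β := by
  intro f α hf hα
  have hle : ∀ n, ‖β (n + 1)‖ ≤ 1 := fun n =>
    (hβ.le_tsum n fun _ _ => norm_nonneg _).trans (hβ'.trans (by norm_num))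
  have hs : ∀ z ∈ unitDisk, Summable fun n : ℕ => α (n + 1) * β (n + 1) * z ^ (n + 1) := by
    intro z hz
    refine Summable.of_norm_bounded (hα z hz).summable.norm fun n => ?_
    rw [mul_right_comm, norm_mul]
    exact mul_le_of_le_one_right (norm_nonneg _) (hle n)
  refine ⟨fun z => ∑' n : ℕ, α (n + 1) * β (n + 1) * z ^ (n + 1), fun z hz => (hs z hz).hasSum,
    hf.isSubordinate (differentiableOn_tsum_pow_unitDisk hs) (by simp) fun z hz => ?_⟩
  simpa only [mul_right_comm] using hf.tsum_mul_mem_image hα hβ hβ' hz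

/-! ### The Wright coefficients -/

theorem two_pow_le_Gamma_one_add {μ : ℝ} (hμ : 2 ≤ μ) (k : ℕ) :
    (2 : ℝ) ^ k ≤ Real.Gamma (1 + k * μ) := by
  -- For `k = 0` the argument `1` lies outside the range `[2, ∞)` where monotonicity of `Γ` is used.
  rcases k.eq_zero_or_pos with rfl | hk
  · simp
  have hk1 : (1 : ℝ) ≤ k := by exact_mod_cast hk
  have hfac : (2 : ℝ) ^ k ≤ Real.Gamma (1 + k * 2) := by
    have h : Real.Gamma (1 + k * 2) = ((2 * k).factorial : ℝ) := by
      rw [← Real.Gamma_nat_eq_factorial]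
      push_cast
      ring_nf
    rw [h]
    exact_mod_cast (Nat.le_mul_of_pos_right _ k.factorial_pos).trans
      (Nat.two_pow_mul_factorial_le_factorial_two_mul k)
  refine hfac.trans (Real.Gamma_strictMonoOn_Ici.monotoneOn ?_ ?_ ?_)
  · simp only [mem_Ici]; linarith
  · simp only [mem_Ici]; nlinarith
  · gcongr

theorem norm_Gamma_one_add (μ : ℝ) (k : ℕ) :
    ‖Complex.Gamma (1 + k * μ)‖ = |Real.Gamma (1 + k * μ)| := by
  rw [← Real.norm_eq_abs, ← Complex.norm_real, ← Complex.Gamma_ofReal]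
  push_cast
  rfl

theorem norm_inv_Gamma_mul_Gamma_le {μ ν : ℝ} (hμ : 2 ≤ μ) (hν : 2 ≤ ν) (k : ℕ) :
    ‖1 / (Complex.Gamma (1 + k * μ) * Complex.Gamma (1 + k * ν))‖ ≤ (1 / 4 : ℝ) ^ k := by
  rw [norm_div, norm_one, norm_mul, norm_Gamma_one_add, norm_Gamma_one_add, one_div_pow]
  have h4 : (4 : ℝ) ^ k = 2 ^ k * 2 ^ k := by rw [← mul_pow]; norm_num
  rw [h4]
  gcongr
  · exact (two_pow_le_Gamma_one_add hμ k).trans (le_abs_self _)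
  · exact (two_pow_le_Gamma_one_add hν k).trans (le_abs_self _)

theorem hasSum_one_quarter_pow_succ : HasSum (fun k : ℕ => (1 / 4 : ℝ) ^ (k + 1)) (1 / 3) := by
  have h := (hasSum_geometric_of_lt_one (r := 1 / 4) (by norm_num) (by norm_num)).mul_right (1 / 4)
  norm_num [pow_succ] at h ⊢
  exact h

theorem norm_wrightTerm_le {μ ν : ℝ} (hμ : 2 ≤ μ) (hν : 2 ≤ ν) {z : ℂ} (hz : z ∈ unitDisk)
    (k : ℕ) : ‖wrightTerm μ 1 ν 1 z k‖ ≤ (1 / 4 : ℝ) ^ k := by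
  have hz' : ‖z‖ ≤ 1 := by simpa [unitDisk] using (Metric.mem_ball.1 hz).le
  rw [wrightTerm, div_eq_mul_one_div, norm_mul, norm_pow]
  exact (mul_le_of_le_one_left (norm_nonneg _) (pow_le_one₀ (norm_nonneg _) hz')).trans
    (norm_inv_Gamma_mul_Gamma_le hμ hν k)

theorem mainTheorem11 (μ ν : ℝ) (hμ : 2 ≤ μ) (hν : 2 ≤ ν) :
    (∀ z ∈ unitDisk, Summable (wrightTerm μ 1 ν 1 z) ∧ 1 / 2 < (wright μ 1 ν 1 z).re) ∧
    IsSubordinatingFactorSeq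
      (fun k : ℕ => 1 / (Complex.Gamma (1 + k * μ) * Complex.Gamma (1 + k * ν))) := by
  constructor
  · intro z hz
    have hs : Summable (wrightTerm μ 1 ν 1 z) := Summable.of_norm_bounded
      (summable_geometric_of_lt_one (by norm_num) (by norm_num)) (norm_wrightTerm_le hμ hν hz)
    refine ⟨hs, ?_⟩
    have h1 : ‖∑' k, wrightTerm μ 1 ν 1 z (k + 1)‖ ≤ 1 / 3 :=
      tsum_of_norm_bounded hasSum_one_quarter_pow_succ fun k => norm_wrightTerm_le hμ hν hz (k + 1)
    have h0 : wrightTerm μ 1 ν 1 z 0 = 1 := by simp [wrightTerm]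
    have h2 := (abs_le.1 ((Complex.abs_re_le_norm _).trans h1)).1
    rw [wright, hs.tsum_eq_zero_add, h0, Complex.add_re, Complex.one_re]
    linarith
  · have hle := fun k : ℕ => norm_inv_Gamma_mul_Gamma_le hμ hν (k + 1)
    have hs := Summable.of_nonneg_of_le (fun _ => norm_nonneg _) hle
      hasSum_one_quarter_pow_succ.summable
    refine isSubordinatingFactorSeq_of_tsum_norm_le hs ?_
    have h := hs.tsum_le_tsum hle hasSum_one_quarter_pow_succ.summable
    rw [hasSum_one_quarter_pow_succ.tsum_eq] at h
    exact h.trans (by norm_num)
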